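/- Let $2\le\hat N\le N$ and let $\mathcal A,\mathcal B\in\mathbb C^{I_1\times\cdots\times I_N}$. For $1\le n\le N$ let $\mathbf T_{(n)}$ denote the $\bigl(\prod_{k\ne n}I_k\bigr)\times I_n$ matrix whose columns are the vectorized mode-$n$ slices of a tensor $\mathcal T$. A tensor $\mathcal T$ is called ML rank-$(L_1,\dots,L_{\hat N},\cdot,\dots,\cdot)$ if $\operatorname{rank}\mathbf T_{(n)}=L_n$ for $n=1,\dots,\hat N$. For $\mathcal D\in\mathbb C^{L_1\times\cdots\times L_{\hat N}\times I_{\hat N+1}\times\cdots\times I_N}$ and $\mathbf X^{(n)}\in\mathbb C^{I_n\times L_n}$, let $\mathcal D\bullet_1\mathbf X^{(1)}\cdots\bullet_{\hat N}\mathbf X^{(\hat N)}$ be the tensor with entries $$\sum_{j_1,\dots,j_{\hat N}}\Bigl(\prod_{n=1}^{\hat N}\mathbf X^{(n)}_{i_nj_n}\Bigr)\,\mathcal D_{j_1,\dots,j_{\hat N},i_{\hat N+1},\dots,i_N}.$$ Assume that $\mathbf A_{(1)},\dots,\mathbf A_{(\hat N)}$ have full column rank, that $\mathbf M_n\in\mathbb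 C^{I_n\times I_n}$ satisfy $\mathbf B_{(n)}=\mathbf A_{(n)}\mathbf M_n$ for $n=1,\dots,\hat N$, and that at least one of $\mathbf M_1,\dots,\mathbf M_{\hat N}$ is diagonalizable. Then the following hold. 1. The matrices $\mathbf M_1,\dots,\mathbf M_{\hat N}$ have the same spectrum (as a set). 2. All matrices $\mathbf M_1,\dots,\mathbf M_{\hat N}$ are diagonalizable. 3. Let $\lambda_1,\dots,\lambda_R$ be the distinct elements of this common spectrum and let $L_{nr}$ be the multiplicity of $\lambda_r$ as an eigenvalue of $\mathbf M_n$. Then for every $n\le\hat N$ there is a square nonsingular matrix $\mathbf X^{(n)}=[\mathbf X^{(n)}_1\ \dots\ \mathbf X^{(n)}_R]$, $\mathbf X^{(n)}_r\in\mathbb C^{I_n\times L_{nr}}$, with $$\mathbf M_n=(\mathbf X^{(n)T})^{-1}\operatorname{Bdiag}(\lambda_1\mathbf I_{L_{n1}},\dots,\lambda_R\mathbf I_{L_{nR}})\,\mathbf X^{(n)T}.\qquad(*)$$ For each $n\le\hat N$, $\lambda_1\cdots\lambda_R\ne0$ if and only if $\mathbf A_{(n)}$ and $\mathbf B_{(n)}$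 have the same column space. Moreover, for every choice of square nonsingular $\mathbf X^{(1)},\dots,\mathbf X^{(\hat N)}$ satisfying $(*)$ there exist tensors $\mathcal D_r\in\mathbb C^{L_{1r}\times\cdots\times L_{\hat Nr}\times I_{\hat N+1}\times\cdots\times I_N}$, $r=1,\dots,R$, such that, with $\mathcal A_r:=\mathcal D_r\bullet_1\mathbf X^{(1)}_r\cdots\bullet_{\hat N}\mathbf X^{(\hat N)}_r$, $$\mathcal A=\sum_{r=1}^R\mathcal A_r,\qquad \mathcal B=\sum_{r=1}^R(\lambda_r\mathcal D_r)\bullet_1\mathbf X^{(1)}_r\cdots\bullet_{\hat N}\mathbf X^{(\hat N)}_r=\sum_{r=1}^R\lambda_r\mathcal A_r,$$ and every $\mathcal A_r$ is ML rank-$(L_{1r},\dots,L_{\hat Nr},\cdot,\dots,\cdot)$; if $\lambda_1\cdots\lambda_R\ne0$, then every term $\lambda_r\mathcal A_r$ of $\mathcal B$ is ML rank-$(L_{1r},\dots,L_{\hat Nr},\cdot,\dots,\cdot)$ as well. In particular, if $\hat N\ge N-1$ and $L_{nr}=1$ for all $n\le\hat N$ and all $r$, then every $\mathcal A_r$ is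 a rank-1 tensor (a nonzero outer product of $N$ vectors), so $\mathcal A$ and $\mathcal B$ are generated by the same (possibly scaled) $R$ rank-1 terms. -/

import Mathlib

open scoped BigOperators

/-- Complex tensors of size `I 0 × ⋯ × I (N-1)`. -/
abbrev Tensor {N : ℕ} (I : Fin N → ℕ) : Type :=
  (∀ n : Fin N, Fin (I n)) → ℂ

/-- The mode-`n` matrix representation: its columns are the mode-`n` slices of the tensor. A row is
indexed by the multi-index of the modes other than `n`. -/
def unfolding {N : ℕ} {I : Fin N → ℕ} (A : Tensor I) (n : Fin N) :
    Matrix (∀ k : {k : Fin N // k ≠ n}, Fin (I k)) (Fin (I n)) ℂ :=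
  Matrix.of fun ρ i => A ((Equiv.piSplitAt n fun k => Fin (I k)).symm (i, ρ))

/-- `A` is ML rank-`(L 0, …, L (P-1), ·, …, ·)`: the first `P` matrix representations of `A` have
the prescribed ranks. -/
def IsMLRank {N P : ℕ} (hP : P ≤ N) {I : Fin N → ℕ} (A : Tensor I) (L : Fin P → ℕ) : Prop :=
  ∀ n : Fin P, (unfolding A (Fin.castLE hP n)).rank = L n

/-- Complex tensors of size `L 0 × ⋯ × L (P-1) × I P × ⋯ × I (N-1)`; the multi-index is split into
the first `P` modes and the remaining ones. -/
abbrev CoreTensor {N P : ℕ} (I : Fin N → ℕ) (L : Fin P → ℕ) : Type :=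
  (∀ n : Fin P, Fin (L n)) → (∀ n : {n : Fin N // P ≤ n.val}, Fin (I n)) → ℂ

/-- The product `D •₁ X₁ ⋯ •_P X_P` of a core tensor with matrices in the first `P` modes. -/
def modeProduct {N P : ℕ} (hP : P ≤ N) {I : Fin N → ℕ} {L : Fin P → ℕ} (D : CoreTensor I L)
    (X : ∀ n : Fin P, Matrix (Fin (I (Fin.castLE hP n))) (Fin (L n)) ℂ) : Tensor I :=
  fun i => ∑ j : (∀ n : Fin P, Fin (L n)),
    (∏ n : Fin P, X n (i (Fin.castLE hP n)) (j n)) * D j (fun k => i k)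

/-- The `r`-th block `X_r` of columns of a concatenated matrix `X = [X_0 ⋯ X_(R-1)]`. -/
def columnBlock {m R : ℕ} {l : Fin R → ℕ} (X : Matrix (Fin m) (Σ r, Fin (l r)) ℂ) (r : Fin R) :
    Matrix (Fin m) (Fin (l r)) ℂ :=
  X.submatrix id (fun j => ⟨r, j⟩)

/-- The `r`-th term `D_r •₁ X_r⁽¹⁾ ⋯ •_P X_r⁽ᴾ⁾` built from cores `D` and concatenated factor
matrices `X`. -/
def mlTerm {N P R : ℕ} (hP : P ≤ N) {I : Fin N → ℕ} {L : Fin P → Fin R → ℕ}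
    (D : ∀ r : Fin R, CoreTensor I (fun n => L n r))
    (X : ∀ n : Fin P, Matrix (Fin (I (Fin.castLE hP n))) (Σ r, Fin (L n r)) ℂ) (r : Fin R) :
    Tensor I :=
  modeProduct hP (D r) (fun n => columnBlock (X n) r)

/-- The cores `D` and concatenated factor matrices `X` form a decomposition of `A` into a sum of `R`
terms, the `r`-th of which is ML rank-`(L 0 r, …, L (P-1) r, ·, …, ·)`. -/
def IsMLRankDecomposition {N P R : ℕ} (hP : P ≤ N) {I : Fin N → ℕ} (A : Tensor I)
    (L : Fin P → Fin R → ℕ) (D : ∀ r : Fin R, CoreTensor I (fun n => L n r))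
    (X : ∀ n : Fin P, Matrix (Fin (I (Fin.castLE hP n))) (Σ r, Fin (L n r)) ℂ) : Prop :=
  A = ∑ r : Fin R, mlTerm hP D X r ∧
    ∀ r : Fin R, IsMLRank hP (mlTerm hP D X r) (fun n => L n r)

/-- A rank-1 tensor: a nonzero outer product of vectors. -/
def IsRankOneTensor {N : ℕ} {I : Fin N → ℕ} (T : Tensor I) : Prop :=
  T ≠ 0 ∧ ∃ x : ∀ n : Fin N, Fin (I n) → ℂ, ∀ i, T i = ∏ n : Fin N, x n (i n)

/-- The column space of a matrix. -/
def columnSpace {m n : Type*} (A : Matrix m n ℂ) : Submodule ℂ (m → ℂ) :=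
  Submodule.span ℂ (Set.range A.col)

/-- `M` is similar to a diagonal matrix over `ℂ`. -/
def IsDiagonalizableMatrix {m : ℕ} (M : Matrix (Fin m) (Fin m) ℂ) : Prop :=
  ∃ (S : Matrix (Fin m) (Fin m) ℂ) (d : Fin m → ℂ),
    IsUnit S ∧ M = S * Matrix.diagonal d * S⁻¹

/-- `X` is square and nonsingular and
`M = (Xᵀ)⁻¹ · Bdiag(ev 0 • I, …, ev (R-1) • I) · Xᵀ` with identity blocks of sizes `l r`.
Squareness and nonsingularity of `X` are expressed by a two-sided inverse `Y`. -/
def IsEigenFactor {m R : ℕ} (M : Matrix (Fin m) (Fin m) ℂ) (ev : Fin R → ℂ) (l : Fin R → ℕ)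
    (X : Matrix (Fin m) (Σ r, Fin (l r)) ℂ) : Prop :=
  ∃ Y : Matrix (Σ r, Fin (l r)) (Fin m) ℂ, X * Y = 1 ∧ Y * X = 1 ∧
    M = Y.transpose *
      Matrix.blockDiagonal' (fun r => ev r • (1 : Matrix (Fin (l r)) (Fin (l r)) ℂ)) *
      X.transpose

/-! The hypothesis says that `M n` acting on `A` in mode `n` gives the same tensor `B` for every
`n`. Actions in different modes commute, so any polynomial in `M n` acts on `A` as the same
polynomial in `M k` (`modeMul_aeval_eq`). Full column rank makes the action on `A` faithful, so all
`M n` have one minimal polynomial (`minpoly_eq_of_modeMul_eq`). This polynomial determines the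
spectrum, and its squarefreeness is diagonalizability.

In eigenvector coordinates in the first `P` modes, `A` becomes a tensor `C`, and `B` becomes `C`
with each entry scaled by the eigenvalue of its `n`-th index, whichever `n` is used. Hence an entry
of `C` vanishes unless all its indices belong to the same eigenvalue; the diagonal blocks of `C` are
the cores (`exists_cores`). The ranks are exact because their upper bounds already add up to the
rank of `A` (`isMLRank_mlTerm`). -/

/-! ### Diagonalizability, minimal polynomials and eigenvector matrices -/

theorem minpoly_squarefree_of_isDiagonalizableMatrix {m : ℕ} {M : Matrix (Fin m) (Fin m) ℂ}
    (h : IsDiagonalizableMatrix M) : Squarefree (minpoly ℂ M) := by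
  obtain ⟨S, d, hS, rfl⟩ := h
  have hdet := (Matrix.isUnit_iff_isUnit_det S).1 hS
  -- One factor per distinct diagonal value: enough to annihilate the matrix, and still squarefree.
  let q : Polynomial ℂ := ∏ c ∈ Finset.univ.image d, (Polynomial.X - Polynomial.C c)
  have hq : Squarefree q :=
    (Polynomial.separable_prod_X_sub_C_iff'.2 (fun x _ y _ h => h)).squarefree
  refine hq.squarefree_of_dvd (minpoly.dvd ℂ _ ?_)
  have hconj : ∀ p : Polynomial ℂ, Polynomial.aeval (S * Matrix.diagonal d * S⁻¹) p =
      S * Matrix.diagonal (fun i => p.eval (d i)) * S⁻¹ := by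
    intro p
    induction p using Polynomial.induction_on' with
    | add p q hp hq =>
      simp only [map_add, hp, hq, Polynomial.eval_add, ← Matrix.diagonal_add, Matrix.mul_add,
        Matrix.add_mul]
    | monomial k a =>
      have hpow : (S * Matrix.diagonal d * S⁻¹) ^ k = S * Matrix.diagonal (d ^ k) * S⁻¹ := by
        rw [← Matrix.diagonal_pow]
        induction k with
        | zero => simp [Matrix.mul_nonsing_inv S hdet]
        | succ k ih =>
          rw [pow_succ, ih, pow_succ]
          simp only [Matrix.mul_assoc]
          rw [← Matrix.mul_assoc S⁻¹ S, Matrix.nonsing_inv_mul S hdet, Matrix.one_mul]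
      rw [Polynomial.aeval_monomial, hpow, Algebra.algebraMap_eq_smul_one, smul_mul_assoc, one_mul]
      rw [show (fun i => (Polynomial.monomial k a).eval (d i)) = a • (d ^ k) by
        ext i; simp [Polynomial.eval_monomial], Matrix.diagonal_smul]
      simp
  rw [hconj, show (fun i => q.eval (d i)) = 0 from ?_]
  · simp
  · ext i
    simp only [q, Polynomial.eval_prod, Pi.zero_apply]
    exact Finset.prod_eq_zero (Finset.mem_image_of_mem d (Finset.mem_univ i)) (by simp)

theorem isDiagonalizableMatrix_of_minpoly_squarefree {m : ℕ} {M : Matrix (Fin m) (Fin m) ℂ}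
    (h : Squarefree (minpoly ℂ M)) : IsDiagonalizableMatrix M := by
  let f : Module.End ℂ (Fin m → ℂ) := Matrix.toLin' M
  have hss : f.IsSemisimple := by
    refine Module.End.isSemisimple_of_squarefree_aeval_eq_zero h ?_
    have := minpoly.aeval ℂ (Matrix.toLinAlgEquiv' M)
    rw [minpoly.algEquiv_eq] at this
    exact this
  have hint : DirectSum.IsInternal f.eigenspace := by
    classical
    rw [DirectSum.isInternal_submodule_iff_iSupIndep_and_iSup_eq_top]
    exact ⟨Module.End.eigenspaces_iSupIndep _, hss.iSup_eigenspace_eq_top⟩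
  classical
  obtain ⟨b, c, hb⟩ : ∃ (b : Module.Basis (Fin m) ℂ (Fin m → ℂ)) (c : Fin m → ℂ),
      ∀ i, M.mulVec (b i) = c i • b i := by
    let b₀ := hint.collectedBasis fun μ => Module.finBasis ℂ (f.eigenspace μ)
    let e := (Pi.basisFun ℂ (Fin m)).indexEquiv b₀
    refine ⟨b₀.reindex e.symm, fun i => (e i).1, fun i => ?_⟩
    rw [Module.Basis.reindex_apply, Equiv.symm_symm]
    exact Module.End.mem_eigenspace_iff.1
      (hint.collectedBasis_mem (fun μ => Module.finBasis ℂ (f.eigenspace μ)) (e i))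
  let S : Matrix (Fin m) (Fin m) ℂ := (Pi.basisFun ℂ (Fin m)).toMatrix b
  have hS : IsUnit S := by
    have : Invertible S := (Pi.basisFun ℂ (Fin m)).invertibleToMatrix b
    exact isUnit_of_invertible S
  have hdet := (Matrix.isUnit_iff_isUnit_det S).1 hS
  refine ⟨S, c, hS, ?_⟩
  have hMS : M * S = S * Matrix.diagonal c := by
    ext i j
    rw [Matrix.mul_diagonal, mul_comm]
    exact congrFun (hb j) i
  rw [← hMS, Matrix.mul_assoc, Matrix.mul_nonsing_inv S hdet, Matrix.mul_one]

theorem mem_spectrum_iff_isRoot_minpoly {m : ℕ} (M : Matrix (Fin m) (Fin m) ℂ) (c : ℂ) :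
    c ∈ spectrum ℂ M ↔ (minpoly ℂ M).IsRoot c := by
  have h : minpoly ℂ (Matrix.toLin' M) = minpoly ℂ M :=
    minpoly.algEquiv_eq (Matrix.toLinAlgEquiv' (R := ℂ) (n := Fin m)) M
  rw [← Matrix.spectrum_toLin', ← Module.End.hasEigenvalue_iff_mem_spectrum,
    Module.End.hasEigenvalue_iff_isRoot, h]

theorem blockDiagonal'_smul_one {R : ℕ} (ev : Fin R → ℂ) (l : Fin R → ℕ) :
    Matrix.blockDiagonal' (fun r => ev r • (1 : Matrix (Fin (l r)) (Fin (l r)) ℂ)) =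
      Matrix.diagonal fun p : Σ r, Fin (l r) => ev p.1 := by
  simp only [← Matrix.diagonal_one, ← Matrix.diagonal_smul, Matrix.blockDiagonal'_diagonal]
  simp

/-- The characteristic polynomial of `S * diagonal d * S⁻¹` is the product of the `X - d i`, so `l
r` counts the `i` with `d i = ev r`. Grouping the indices by eigenvalue turns the transpose of `S⁻¹`
into the required factor. -/
theorem exists_isEigenFactor {m R : ℕ} {M : Matrix (Fin m) (Fin m) ℂ}
    (h : IsDiagonalizableMatrix M) {ev : Fin R → ℂ} {l : Fin R → ℕ}
    (hev : Function.Injective ev) (hspec : spectrum ℂ M = Set.range ev)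
    (hl : ∀ r, M.charpoly.rootMultiplicity (ev r) = l r) :
    ∃ X : Matrix (Fin m) (Σ r, Fin (l r)) ℂ, IsEigenFactor M ev l X := by
  classical
  obtain ⟨S, d, hS, rfl⟩ := h
  have hdet := (Matrix.isUnit_iff_isUnit_det S).1 hS
  obtain ⟨u, rfl⟩ := hS
  have hinv : (u : Matrix (Fin m) (Fin m) ℂ)⁻¹ = (u⁻¹ : (Matrix (Fin m) (Fin m) ℂ)ˣ) :=
    (Matrix.coe_units_inv u).symm
  rw [hinv, spectrum.units_conjugate, spectrum_diagonal] at hspec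
  simp only [Matrix.charpoly_units_conj] at hl
  simp only [Matrix.charpoly_diagonal] at hl
  have hd : ∀ i, ∃ r, ev r = d i := fun i => hspec.subset (Set.mem_range_self i)
  choose f hf using hd
  have hcard : ∀ r, Fintype.card {i // f i = r} = l r := by
    intro r
    rw [← hl r, ← Polynomial.count_roots, Fintype.card_subtype,
      show ∏ i, (Polynomial.X - Polynomial.C (d i)) =
        ((Finset.univ.val.map d).map fun a => Polynomial.X - Polynomial.C a).prod by
          rw [Multiset.map_map]; rfl,
      Polynomial.roots_multiset_prod_X_sub_C, Multiset.count_map, Finset.card_def]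
    congr 1
    rw [Finset.filter_val]
    refine Multiset.filter_congr fun i _ => ?_
    rw [← hf, hev.eq_iff, eq_comm]
  let e : Fin m ≃ Σ r, Fin (l r) :=
    (Equiv.sigmaFiberEquiv f).symm.trans
      (Equiv.sigmaCongrRight fun r => Fintype.equivFinOfCardEq (hcard r))
  have he : ∀ i, (e i).1 = f i := fun i => rfl
  have hSS := Matrix.mul_nonsing_inv _ hdet
  have hSS' := Matrix.nonsing_inv_mul _ hdet
  rw [hinv] at hSS hSS'
  set T : Matrix (Fin m) (Fin m) ℂ := (u⁻¹ : (Matrix (Fin m) (Fin m) ℂ)ˣ).val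
  set S : Matrix (Fin m) (Fin m) ℂ := u.val
  refine ⟨T.transpose.submatrix id e.symm, S.transpose.submatrix e.symm id, ?_, ?_, ?_⟩
  · rw [Matrix.submatrix_mul_equiv, ← Matrix.transpose_mul, hSS]; simp
  · rw [← Matrix.submatrix_mul _ _ _ id _ Function.bijective_id, ← Matrix.transpose_mul, hSS']; simp
  · have : (fun p : Σ r, Fin (l r) => ev p.1) = d ∘ e.symm := by
      ext p
      rw [Function.comp_apply, ← hf, ← he, e.apply_symm_apply]
    rw [blockDiagonal'_smul_one, this, ← Matrix.submatrix_diagonal_equiv,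
      Matrix.transpose_submatrix, Matrix.transpose_submatrix, Matrix.transpose_transpose,
      Matrix.transpose_transpose, Matrix.submatrix_mul_equiv, Matrix.submatrix_mul_equiv,
      Matrix.submatrix_id_id, hinv]

/-! ### Algebra of mode products -/

/-- The product of a tensor with a square matrix acting on the single mode `n`. -/
def modeMul {κ : Type*} [DecidableEq κ] {ι : κ → Type*} [∀ k, Fintype (ι k)] (n : κ)
    (G : Matrix (ι n) (ι n) ℂ) (T : (∀ k, ι k) → ℂ) : (∀ k, ι k) → ℂ :=
  fun i => ∑ x, T (Function.update i n x) * G x (i n)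

/-- The product of a tensor with one matrix in every mode. -/
def multiMul {κ : Type*} [Fintype κ] [DecidableEq κ] {ι ι' : κ → Type*} [∀ k, Fintype (ι' k)]
    (X : ∀ k, Matrix (ι k) (ι' k) ℂ) (T : (∀ k, ι' k) → ℂ) : (∀ k, ι k) → ℂ :=
  fun i => ∑ j : (∀ k, ι' k), (∏ k, X k (i k) (j k)) * T j

theorem modeMul_comm {κ : Type*} [DecidableEq κ] {ι : κ → Type*} [∀ k, Fintype (ι k)] {n k : κ}
    (h : n ≠ k) (G : Matrix (ι n) (ι n) ℂ) (H : Matrix (ι k) (ι k) ℂ) (T : (∀ k, ι k) → ℂ) :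
    modeMul n G (modeMul k H T) = modeMul k H (modeMul n G T) := by
  ext i
  simp only [modeMul, Finset.sum_mul, Function.update_of_ne h, Function.update_of_ne h.symm]
  rw [Finset.sum_comm]
  refine Finset.sum_congr rfl fun x _ => Finset.sum_congr rfl fun y _ => ?_
  rw [Function.update_comm h]
  ring

theorem modeMul_diagonal {κ : Type*} [DecidableEq κ] {ι : κ → Type*} [∀ k, Fintype (ι k)]
    [∀ k, DecidableEq (ι k)] (n : κ) (d : ι n → ℂ) (T : (∀ k, ι k) → ℂ) (i : ∀ k, ι k) :
    modeMul n (Matrix.diagonal d) T i = d (i n) * T i := by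
  rw [modeMul, Finset.sum_eq_single (i n)]
  · simp [mul_comm]
  · intro x _ hx
    rw [Matrix.diagonal_apply_ne _ hx, mul_zero]
  · simp

theorem prod_one_apply {κ : Type*} [Fintype κ] {ι : κ → Type*} [∀ k, DecidableEq (ι k)] (i j : ∀ k, ι k) :
    ∏ k, (1 : Matrix (ι k) (ι k) ℂ) (i k) (j k) = if i = j then 1 else 0 := by
  simp only [Matrix.one_apply, Finset.prod_ite_zero, Finset.prod_const_one, Finset.mem_univ,
    true_implies, funext_iff]

section MultiMul

variable {κ : Type*} [Fintype κ] [DecidableEq κ] {ι ι' ι'' : κ → Type*}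

theorem multiMul_multiMul [∀ k, Fintype (ι' k)] [∀ k, Fintype (ι'' k)]
    (X : ∀ k, Matrix (ι k) (ι' k) ℂ) (Y : ∀ k, Matrix (ι' k) (ι'' k) ℂ) (T : (∀ k, ι'' k) → ℂ) :
    multiMul X (multiMul Y T) = multiMul (fun k => X k * Y k) T := by
  ext i
  simp only [multiMul, Finset.mul_sum]
  rw [Finset.sum_comm]
  refine Finset.sum_congr rfl fun j _ => ?_
  simp only [Matrix.mul_apply, Finset.prod_univ_sum, Fintype.piFinset_univ, Finset.sum_mul,
    Finset.prod_mul_distrib, mul_assoc]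

theorem multiMul_one [∀ k, Fintype (ι k)] [∀ k, DecidableEq (ι k)] (T : (∀ k, ι k) → ℂ) :
    multiMul (fun k => (1 : Matrix (ι k) (ι k) ℂ)) T = T := by
  ext i
  simp [multiMul, prod_one_apply]

/-- The transpose appears because `modeMul` contracts the row index of its matrix and `multiMul` the
column index. -/
theorem modeMul_eq_multiMul [∀ k, Fintype (ι k)] [∀ k, DecidableEq (ι k)] (n : κ)
    (G : Matrix (ι n) (ι n) ℂ) (T : (∀ k, ι k) → ℂ) :
    modeMul n G T = multiMul (Function.update (fun k => (1 : Matrix (ι k) (ι k) ℂ)) n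
      G.transpose) T := by
  ext i
  refine Fintype.sum_of_injective (Function.update i n) (Function.update_injective i n) _ _ ?_ ?_
  · intro j hj
    obtain ⟨k, hk, hne⟩ : ∃ k, k ≠ n ∧ i k ≠ j k := by
      by_contra! hcon
      refine hj ⟨j n, ?_⟩
      ext k
      by_cases hk : k = n
      · subst hk; simp
      · rw [Function.update_of_ne hk, hcon k hk]
    rw [Finset.prod_eq_zero (Finset.mem_univ k), zero_mul]
    rw [Function.update_of_ne hk, Matrix.one_apply_ne hne]
  · intro x
    rw [Finset.prod_eq_single n]
    · simp [mul_comm]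
    · intro k _ hk
      simp [Function.update_of_ne hk]
    · simp

theorem multiMul_modeMul [∀ k, Fintype (ι k)] [∀ k, DecidableEq (ι k)] [∀ k, Fintype (ι' k)]
    [∀ k, DecidableEq (ι' k)] (Y : ∀ k, Matrix (ι' k) (ι k) ℂ) (n : κ)
    {G : Matrix (ι n) (ι n) ℂ} {H : Matrix (ι' n) (ι' n) ℂ}
    (h : G * (Y n).transpose = (Y n).transpose * H) (T : (∀ k, ι k) → ℂ) :
    multiMul Y (modeMul n G T) = modeMul n H (multiMul Y T) := by
  rw [modeMul_eq_multiMul, modeMul_eq_multiMul, multiMul_multiMul, multiMul_multiMul]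
  congr 1
  ext1 k
  by_cases hk : k = n
  · subst hk
    have := congrArg Matrix.transpose h
    simpa [Matrix.transpose_mul] using this
  · simp [Function.update_of_ne hk]

end MultiMul

/-- Only multi-indices lying in a single block contribute. Positivity of `P` matters: the empty
multi-index would be counted once for every `r`. -/
theorem multiMul_eq_sum_columnBlock {P R : ℕ} (hP : 0 < P) {m : Fin P → ℕ}
    {L : Fin P → Fin R → ℕ} (X : ∀ n, Matrix (Fin (m n)) (Σ r, Fin (L n r)) ℂ)
    (C : (∀ n, Σ r, Fin (L n r)) → ℂ)
    (hC : ∀ j n k, (j n).1 ≠ (j k).1 → C j = 0) :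
    multiMul X C = ∑ r, multiMul (fun n => columnBlock (X n) r) fun a => C fun n => ⟨r, a n⟩ := by
  ext i
  rw [Finset.sum_apply]
  simp only [multiMul]
  rw [← Fintype.sum_sigma' (f := fun r (a : ∀ n, Fin (L n r)) =>
    (∏ n, columnBlock (X n) r (i n) (a n)) * C fun n => ⟨r, a n⟩)]
  symm
  refine Fintype.sum_of_injective (fun p n => ⟨p.1, p.2 n⟩) ?_ _ _ ?_ fun _ => rfl
  · rintro ⟨r, a⟩ ⟨s, b⟩ h
    have h' := fun n => congrFun h n
    obtain rfl : r = s := congrArg Sigma.fst (h' ⟨0, hP⟩)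
    congr 1
    ext1 n
    simpa using h' n
  · intro j hj
    rw [mul_eq_zero]
    right
    by_contra hne
    have hall : ∀ n, (j n).1 = (j ⟨0, hP⟩).1 := fun n => by
      by_contra h
      exact hne (hC j _ _ h)
    refine hj ⟨⟨(j ⟨0, hP⟩).1, fun n => Fin.cast (congrArg (L n) (hall n)) (j n).2⟩, ?_⟩
    ext n
    · exact congrArg Fin.val (hall n).symm
    · refine (Fin.heq_ext_iff (congrArg (L n) (hall n).symm)).2 rfl

/-! ### Matrices of full column rank and subadditivity of rank -/

theorem mulVec_injective_of_rank_eq {α : Type*} [Fintype α] {m : ℕ} {U : Matrix α (Fin m) ℂ}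
    (h : U.rank = m) : Function.Injective U.mulVec := by
  have h1 := LinearMap.finrank_range_add_finrank_ker U.mulVecLin
  rw [← Matrix.rank, h, Module.finrank_fin_fun] at h1
  have h2 : LinearMap.ker U.mulVecLin = ⊥ := Submodule.finrank_eq_zero.1 (by omega)
  exact LinearMap.ker_eq_bot.1 h2

theorem eq_of_mul_eq_mul_left {α β γ : Type*} [Fintype β] {U : Matrix α β ℂ}
    (hU : Function.Injective U.mulVec) {G H : Matrix β γ ℂ} (h : U * G = U * H) : G = H := by
  ext i j
  have hcol : U.mulVec (G.col j) = U.mulVec (H.col j) := by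
    ext a
    exact congrFun (congrFun h a) j
  exact congrFun (hU hcol) i

theorem columnSpace_mul_eq_iff {α : Type*} {m : ℕ} {U : Matrix α (Fin m) ℂ}
    (hU : Function.Injective U.mulVec) (M : Matrix (Fin m) (Fin m) ℂ) :
    columnSpace U = columnSpace (U * M) ↔ IsUnit M := by
  have hinj : Function.Injective U.mulVecLin := hU
  rw [columnSpace, columnSpace, ← Matrix.range_mulVecLin, ← Matrix.range_mulVecLin,
    Matrix.mulVecLin_mul, LinearMap.range_comp, LinearMap.range_eq_map,
    (Submodule.map_injective_of_injective hinj).eq_iff, eq_comm, LinearMap.range_eq_top]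
  exact Matrix.mulVec_surjective_iff_isUnit

theorem rank_sum_le {α β σ : Type*} [Fintype β] [Fintype α]
    (s : Finset σ) (U : σ → Matrix α β ℂ) :
    (∑ r ∈ s, U r).rank ≤ ∑ r ∈ s, (U r).rank := by
  classical
  have hadd : ∀ V W : Matrix α β ℂ, (V + W).rank ≤ V.rank + W.rank := by
    intro V W
    rw [Matrix.rank, Matrix.rank, Matrix.rank, Matrix.mulVecLin_add]
    refine (Submodule.finrank_mono (LinearMap.range_add_le _ _)).trans ?_
    exact Submodule.finrank_add_le_finrank_add_finrank _ _
  induction s using Finset.induction_on with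
  | empty => simp
  | insert a s ha ih =>
    rw [Finset.sum_insert ha, Finset.sum_insert ha]
    exact (hadd _ _).trans (by omega)

/-! ### Unfoldings, the common minimal polynomial, and subtensors -/

section Unfolding

variable {N P : ℕ} {I : Fin N → ℕ}

theorem unfolding_injective (n : Fin N) :
    Function.Injective fun A : Tensor I => unfolding A n := by
  intro A B h
  ext i
  have := congrFun (congrFun h (Equiv.piSplitAt n (fun k => Fin (I k)) i).2) (i n)
  have hi : (Equiv.piSplitAt n fun k => Fin (I k)).symm
      (i n, (Equiv.piSplitAt n (fun k => Fin (I k)) i).2) = i :=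
    (Equiv.piSplitAt n fun k => Fin (I k)).symm_apply_apply i
  simpa only [unfolding, Matrix.of_apply, hi] using this

theorem unfolding_modeMul (n : Fin N) (G : Matrix (Fin (I n)) (Fin (I n)) ℂ) (A : Tensor I) :
    unfolding (modeMul n G A) n = unfolding A n * G := by
  ext ρ i
  rw [Matrix.mul_apply]
  simp only [unfolding, Matrix.of_apply, modeMul]
  refine Finset.sum_congr rfl fun x _ => ?_
  congr 2
  · ext1 k
    by_cases hk : k = n
    · subst hk; simp
    · simp [hk]
  · simp

theorem unfolding_sum {σ : Type*} (s : Finset σ) (A : σ → Tensor I) (n : Fin N) :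
    unfolding (∑ r ∈ s, A r) n = ∑ r ∈ s, unfolding (A r) n := by
  ext ρ i
  simp only [unfolding, Matrix.of_apply, Matrix.sum_apply, Finset.sum_apply]

theorem modeMul_aeval_eq {n k : Fin N} (hnk : n ≠ k) {M : Matrix (Fin (I n)) (Fin (I n)) ℂ}
    {M' : Matrix (Fin (I k)) (Fin (I k)) ℂ} {A : Tensor I} (h : modeMul n M A = modeMul k M' A)
    (p : Polynomial ℂ) :
    modeMul n (Polynomial.aeval M p) A = modeMul k (Polynomial.aeval M' p) A := by
  have hadd : ∀ (n : Fin N) (G H : Matrix (Fin (I n)) (Fin (I n)) ℂ),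
      modeMul n (G + H) A = modeMul n G A + modeMul n H A := by
    intro n G H
    ext i
    simp [modeMul, mul_add, Finset.sum_add_distrib]
  have hsmul : ∀ (n : Fin N) (c : ℂ) (G : Matrix (Fin (I n)) (Fin (I n)) ℂ),
      modeMul n (c • G) A = c • modeMul n G A := by
    intro n c G
    ext i
    simp [modeMul, Finset.mul_sum, mul_left_comm]
  have hmul : ∀ (n : Fin N) (G H : Matrix (Fin (I n)) (Fin (I n)) ℂ),
      modeMul n (G * H) A = modeMul n H (modeMul n G A) := by
    intro n G H
    apply unfolding_injective n
    simp only [unfolding_modeMul, Matrix.mul_assoc]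
  have hone : ∀ n : Fin N, modeMul n 1 A = A := by
    intro n
    apply unfolding_injective n
    simp only [unfolding_modeMul, Matrix.mul_one]
  induction p using Polynomial.induction_on' with
  | add p q hp hq => rw [map_add, map_add, hadd, hadd, hp, hq]
  | monomial d c =>
    rw [Polynomial.aeval_monomial, Polynomial.aeval_monomial, ← Algebra.smul_def,
      ← Algebra.smul_def, hsmul, hsmul]
    congr 1
    induction d with
    | zero => rw [pow_zero, pow_zero, hone, hone]
    -- The power already moved to mode `k` commutes past the remaining factor in mode `n`, which
    -- then meets `A` and moves as well.
    | succ d ih => rw [pow_succ, hmul, ih, modeMul_comm hnk, h, ← hmul, pow_succ']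

theorem minpoly_eq_of_modeMul_eq {n k : Fin N} {M : Matrix (Fin (I n)) (Fin (I n)) ℂ}
    {M' : Matrix (Fin (I k)) (Fin (I k)) ℂ} {A : Tensor I} (hnk : n ≠ k)
    (h : modeMul n M A = modeMul k M' A)
    (hn : (unfolding A n).rank = I n) (hk : (unfolding A k).rank = I k) :
    minpoly ℂ M = minpoly ℂ M' := by
  have key : ∀ {n k : Fin N} {M : Matrix (Fin (I n)) (Fin (I n)) ℂ}
      {M' : Matrix (Fin (I k)) (Fin (I k)) ℂ}, n ≠ k → modeMul n M A = modeMul k M' A →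
      (unfolding A n).rank = I n → minpoly ℂ M ∣ minpoly ℂ M' := by
    intro n k M M' hnk h hn
    refine minpoly.dvd ℂ M ?_
    have h0 : modeMul n (Polynomial.aeval M (minpoly ℂ M')) A = 0 := by
      rw [modeMul_aeval_eq hnk h, minpoly.aeval]
      ext i
      simp [modeMul]
    refine eq_of_mul_eq_mul_left (mulVec_injective_of_rank_eq hn) ?_
    rw [← unfolding_modeMul, h0, Matrix.mul_zero]
    rfl
  exact Polynomial.eq_of_monic_of_associated (minpoly.monic (Matrix.isIntegral M))
    (minpoly.monic (Matrix.isIntegral M'))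
    (associated_of_dvd_dvd (key hnk h hn) (key hnk.symm h.symm hk))

/-- The multi-index of a tensor assembled from the first `P` indices and the remaining ones. -/
def joinIndex (hP : P ≤ N) (i : ∀ n : Fin P, Fin (I (Fin.castLE hP n)))
    (ρ : ∀ n : {n : Fin N // P ≤ n.val}, Fin (I n)) : ∀ n : Fin N, Fin (I n) :=
  fun n => if h : n.val < P then i ⟨n.val, h⟩ else ρ ⟨n, not_lt.1 h⟩

/-- The subtensor in the first `P` modes obtained by fixing the remaining indices. -/
def subtensor (hP : P ≤ N) (A : Tensor I) (ρ : ∀ n : {n : Fin N // P ≤ n.val}, Fin (I n)) :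
    (∀ n : Fin P, Fin (I (Fin.castLE hP n))) → ℂ :=
  fun i => A (joinIndex hP i ρ)

theorem joinIndex_castLE (hP : P ≤ N) (i : ∀ n : Fin P, Fin (I (Fin.castLE hP n)))
    (ρ : ∀ n : {n : Fin N // P ≤ n.val}, Fin (I n)) (n : Fin P) :
    joinIndex hP i ρ (Fin.castLE hP n) = i n :=
  dif_pos n.isLt

theorem joinIndex_of_le (hP : P ≤ N) (i : ∀ n : Fin P, Fin (I (Fin.castLE hP n)))
    (ρ : ∀ n : {n : Fin N // P ≤ n.val}, Fin (I n)) (n : {n : Fin N // P ≤ n.val}) :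
    joinIndex hP i ρ n = ρ n :=
  dif_neg (not_lt.2 n.2)

theorem joinIndex_restrict (hP : P ≤ N) (i : ∀ n : Fin N, Fin (I n)) :
    joinIndex hP (fun n => i (Fin.castLE hP n)) (fun n => i n) = i := by
  ext1 n
  unfold joinIndex
  split_ifs <;> rfl

theorem subtensor_injective (hP : P ≤ N) :
    Function.Injective fun A : Tensor I => subtensor hP A := by
  intro A B h
  ext i
  have := congrFun (congrFun h fun n => i n) fun n => i (Fin.castLE hP n)
  simpa only [subtensor, joinIndex_restrict] using this

theorem subtensor_sum (hP : P ≤ N) {σ : Type*} (s : Finset σ) (A : σ → Tensor I)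
    (ρ : ∀ n : {n : Fin N // P ≤ n.val}, Fin (I n)) :
    subtensor hP (∑ r ∈ s, A r) ρ = ∑ r ∈ s, subtensor hP (A r) ρ := by
  ext i
  simp only [subtensor, Finset.sum_apply]

theorem subtensor_modeProduct (hP : P ≤ N) {L : Fin P → ℕ} (D : CoreTensor I L)
    (X : ∀ n : Fin P, Matrix (Fin (I (Fin.castLE hP n))) (Fin (L n)) ℂ)
    (ρ : ∀ n : {n : Fin N // P ≤ n.val}, Fin (I n)) :
    subtensor hP (modeProduct hP D X) ρ = multiMul X fun j => D j ρ := by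
  ext i
  simp only [subtensor, modeProduct, multiMul, joinIndex_castLE, joinIndex_of_le]

theorem subtensor_modeMul (hP : P ≤ N) (A : Tensor I) (n : Fin P)
    (G : Matrix (Fin (I (Fin.castLE hP n))) (Fin (I (Fin.castLE hP n))) ℂ)
    (ρ : ∀ n : {n : Fin N // P ≤ n.val}, Fin (I n)) :
    subtensor hP (modeMul (Fin.castLE hP n) G A) ρ = modeMul n G (subtensor hP A ρ) := by
  ext i
  simp only [subtensor, modeMul, joinIndex_castLE]
  refine Finset.sum_congr rfl fun x _ => ?_
  congr 2
  ext1 k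
  by_cases hk : k = Fin.castLE hP n
  · subst hk
    rw [joinIndex_castLE, Function.update_self, Function.update_self]
  · rw [Function.update_of_ne hk]
    unfold joinIndex
    split_ifs with h
    · rw [Function.update_of_ne]
      rintro rfl
      exact hk rfl
    · rfl

/-- The projection `X n * Y` fixes the columns of `X n`, so its action in mode `n` fixes the tensor.
The unfolding therefore factors through a space of dimension `L n`. -/
theorem rank_unfolding_modeProduct_le (hP : P ≤ N) {L : Fin P → ℕ} (D : CoreTensor I L)
    (X : ∀ n : Fin P, Matrix (Fin (I (Fin.castLE hP n))) (Fin (L n)) ℂ) (n : Fin P)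
    {Y : Matrix (Fin (L n)) (Fin (I (Fin.castLE hP n))) ℂ} (hY : Y * X n = 1) :
    (unfolding (modeProduct hP D X) (Fin.castLE hP n)).rank ≤ L n := by
  have h : modeMul (Fin.castLE hP n) (X n * Y).transpose (modeProduct hP D X) =
      modeProduct hP D X := by
    apply subtensor_injective hP
    ext1 ρ
    simp only [subtensor_modeMul, subtensor_modeProduct]
    rw [← multiMul_modeMul X n (G := 1)]
    · rw [← Matrix.diagonal_one]
      congr 1
      ext i
      rw [modeMul_diagonal, one_mul]
    · rw [← Matrix.transpose_mul, Matrix.mul_assoc, hY, Matrix.mul_one, Matrix.one_mul]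
  rw [← h, unfolding_modeMul, Matrix.transpose_mul, ← Matrix.mul_assoc]
  refine (Matrix.rank_mul_le_left _ _).trans ((Matrix.rank_le_card_width _).trans ?_)
  rw [Fintype.card_fin]

end Unfolding

/-! ### Cores, exact ranks and rank-1 terms -/

section Decomposition

variable {N P R : ℕ} {I : Fin N → ℕ}

theorem IsEigenFactor.sum_eq {m : ℕ} {M : Matrix (Fin m) (Fin m) ℂ} {ev : Fin R → ℂ}
    {l : Fin R → ℕ} {X : Matrix (Fin m) (Σ r, Fin (l r)) ℂ} (h : IsEigenFactor M ev l X) :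
    ∑ r, l r = m := by
  obtain ⟨Y, hXY, hYX, -⟩ := h
  have := Matrix.square_of_invertible X Y hXY hYX
  simpa using this.symm

theorem mlTerm_smul (hP : P ≤ N) {L : Fin P → Fin R → ℕ}
    (D : ∀ r : Fin R, CoreTensor I (fun n => L n r))
    (X : ∀ n : Fin P, Matrix (Fin (I (Fin.castLE hP n))) (Σ r, Fin (L n r)) ℂ)
    (c : Fin R → ℂ) (r : Fin R) :
    mlTerm hP (fun r => c r • D r) X r = c r • mlTerm hP D X r := by
  ext i
  simp only [mlTerm, modeProduct, Pi.smul_apply, smul_eq_mul, Finset.mul_sum]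
  exact Finset.sum_congr rfl fun j _ => by ring

theorem exists_cores (hP2 : 2 ≤ P) (hP : P ≤ N) {A B : Tensor I}
    {M : ∀ n : Fin P, Matrix (Fin (I (Fin.castLE hP n))) (Fin (I (Fin.castLE hP n))) ℂ}
    (hB : ∀ n, B = modeMul (Fin.castLE hP n) (M n) A) {ev : Fin R → ℂ}
    (hev : Function.Injective ev) {L : Fin P → Fin R → ℕ}
    {X : ∀ n : Fin P, Matrix (Fin (I (Fin.castLE hP n))) (Σ r, Fin (L n r)) ℂ}
    (hX : ∀ n, IsEigenFactor (M n) ev (L n) (X n)) :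
    ∃ D : ∀ r : Fin R, CoreTensor I (fun n => L n r),
      A = ∑ r, mlTerm hP D X r ∧ B = ∑ r, mlTerm hP (fun r => ev r • D r) X r := by
  choose Y hXY hYX hM using hX
  let C := fun ρ => multiMul Y (subtensor hP A ρ)
  have hCB : ∀ n ρ j, multiMul Y (subtensor hP B ρ) j = ev (j n).1 * C ρ j := by
    intro n ρ j
    rw [hB n, subtensor_modeMul, multiMul_modeMul Y n (H := Matrix.diagonal fun p => ev p.1),
      modeMul_diagonal]
    rw [hM n, blockDiagonal'_smul_one, Matrix.mul_assoc, ← Matrix.transpose_mul, hYX,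
      Matrix.transpose_one, Matrix.mul_one]
  -- Modes `n` and `k` scale the same entry by distinct eigenvalues with the same result, so the
  -- entry is zero.
  have hsupp : ∀ ρ j n k, (j n).1 ≠ (j k).1 → C ρ j = 0 := by
    intro ρ j n k hjk
    have h := (hCB n ρ j).symm.trans (hCB k ρ j)
    rw [← sub_eq_zero, ← sub_mul, mul_eq_zero, sub_eq_zero] at h
    exact h.resolve_left fun h' => hjk (hev h')
  have hid : ∀ T, multiMul X (multiMul Y T) = T := by
    intro T
    rw [multiMul_multiMul]
    simp only [hXY, multiMul_one]
  let n₀ : Fin P := ⟨0, by omega⟩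
  refine ⟨fun r a ρ => C ρ fun n => ⟨r, a n⟩, ?_, ?_⟩
  · apply subtensor_injective hP
    ext1 ρ
    simp only [subtensor_sum, mlTerm, subtensor_modeProduct]
    rw [← multiMul_eq_sum_columnBlock (by omega) X (C ρ) (hsupp ρ), hid]
  · apply subtensor_injective hP
    ext1 ρ
    simp only [subtensor_sum, mlTerm, subtensor_modeProduct]
    rw [← hid (subtensor hP B ρ), multiMul_eq_sum_columnBlock (by omega) X]
    · simp only [hCB n₀]
      rfl
    · intro j n k hjk
      rw [hCB n, hsupp ρ j n k hjk, mul_zero]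

/-- Each rank is at most `L n r`, these bounds sum to the rank of the unfolded `A`, and rank is
subadditive; hence every bound is attained. -/
theorem isMLRank_mlTerm (hP : P ≤ N) {A : Tensor I}
    (hA : IsMLRank hP A (fun n => I (Fin.castLE hP n))) {L : Fin P → Fin R → ℕ}
    {D : ∀ r : Fin R, CoreTensor I (fun n => L n r)}
    {X : ∀ n : Fin P, Matrix (Fin (I (Fin.castLE hP n))) (Σ r, Fin (L n r)) ℂ}
    (hX : ∀ n, ∃ Y : Matrix (Σ r, Fin (L n r)) (Fin (I (Fin.castLE hP n))) ℂ, Y * X n = 1) (hL : ∀ n, ∑ r, L n r = I (Fin.castLE hP n))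
    (hsum : A = ∑ r, mlTerm hP D X r) (r : Fin R) :
    IsMLRank hP (mlTerm hP D X r) (fun n => L n r) := by
  intro n
  have hle : ∀ s ∈ Finset.univ,
      (unfolding (mlTerm hP D X s) (Fin.castLE hP n)).rank ≤ L n s := by
    intro s _
    choose Y hY using hX
    refine rank_unfolding_modeProduct_le hP (D s) _ n
      (Y := (Y n).submatrix (fun a => ⟨s, a⟩) id) ?_
    rw [columnBlock, ← Matrix.submatrix_mul _ _ _ id _ Function.bijective_id, hY,
      Matrix.submatrix_one]
    exact fun a b h => by simpa using h
  refine (Finset.sum_eq_sum_iff_of_le hle).1 ?_ r (Finset.mem_univ r)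
  refine le_antisymm (Finset.sum_le_sum hle) ?_
  rw [hL n]
  refine (hA n).symm.trans_le ?_
  rw [congrArg (fun T => unfolding T (Fin.castLE hP n)) hsum, unfolding_sum]
  exact rank_sum_le _ _

/-- With all `L n = 1` the core depends on at most one remaining index: it is a scalar, absorbed
into the first vector, or itself the vector of the last mode. -/
theorem isRankOneTensor_modeProduct (hP2 : 2 ≤ P) (hP : P ≤ N) (hN : N ≤ P + 1) {L : Fin P → ℕ}
    (hL : ∀ n, L n = 1) (D : CoreTensor I L)
    (X : ∀ n : Fin P, Matrix (Fin (I (Fin.castLE hP n))) (Fin (L n)) ℂ)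
    (hne : modeProduct hP D X ≠ 0) : IsRankOneTensor (modeProduct hP D X) := by
  refine ⟨hne, ?_⟩
  obtain rfl : L = fun _ => 1 := funext hL
  -- Any multi-index would do; it only supplies values for modes on which the core's argument does
  -- not depend.
  obtain ⟨i₀, -⟩ := Function.ne_iff.1 hne
  have hval : ∀ i, modeProduct hP D X i =
      (∏ n, X n (i (Fin.castLE hP n)) 0) * D (fun _ => 0) fun k => i k := by
    intro i
    rw [modeProduct, Fintype.sum_unique]
    rfl
  obtain rfl | rfl : N = P ∨ N = P + 1 := by omega
  · let n₀ : Fin N := ⟨0, by omega⟩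
    refine ⟨fun n x => X n x 0 * if n = n₀ then D (fun _ => 0) fun k => i₀ k else 1,
      fun i => ?_⟩
    have hk : (fun k : {n : Fin N // N ≤ n.val} => i k) = fun k : {n : Fin N // N ≤ n.val} => i₀ k := by
      ext1 k
      exact absurd k.1.isLt (not_lt.2 k.2)
    rw [hval, hk, Finset.prod_mul_distrib, Finset.prod_ite_eq' ]
    simp
  · refine ⟨Fin.lastCases (fun x => D (fun _ => 0) fun k => Function.update i₀ (Fin.last P) x k)
      (fun n x => X n x 0), fun i => ?_⟩
    rw [hval, Fin.prod_univ_castSucc]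
    simp only [Fin.lastCases_castSucc, Fin.lastCases_last]
    congr 2
    ext1 k
    obtain ⟨k, hk⟩ := k
    obtain rfl : k = Fin.last P := Fin.ext (le_antisymm (Nat.le_of_lt_succ k.isLt) hk)
    simp

end Decomposition

/-! ### Assembly -/

theorem mainTheorem3 (N P : ℕ) (hP2 : 2 ≤ P) (hPN : P ≤ N) (I : Fin N → ℕ)
    (A B : Tensor I)
    (hA : IsMLRank hPN A (fun n => I (Fin.castLE hPN n)))
    (M : ∀ n : Fin P, Matrix (Fin (I (Fin.castLE hPN n))) (Fin (I (Fin.castLE hPN n))) ℂ)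
    (hM : ∀ n : Fin P,
      unfolding B (Fin.castLE hPN n) = unfolding A (Fin.castLE hPN n) * M n)
    (hdiag : ∃ n : Fin P, IsDiagonalizableMatrix (M n)) :
    (∀ n k : Fin P, spectrum ℂ (M n) = spectrum ℂ (M k)) ∧
    (∀ n : Fin P, IsDiagonalizableMatrix (M n)) ∧
    (∀ (R : ℕ) (ev : Fin R → ℂ) (L : Fin P → Fin R → ℕ),
      Function.Injective ev →
      (∀ n : Fin P, spectrum ℂ (M n) = Set.range ev) →
      (∀ (n : Fin P) (r : Fin R), (M n).charpoly.rootMultiplicity (ev r) = L n r) →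
      (∃ X : ∀ n : Fin P, Matrix (Fin (I (Fin.castLE hPN n))) (Σ r, Fin (L n r)) ℂ,
        ∀ n : Fin P, IsEigenFactor (M n) ev (L n) (X n)) ∧
      (∀ n : Fin P, (∏ r, ev r ≠ 0) ↔
        columnSpace (unfolding A (Fin.castLE hPN n)) =
          columnSpace (unfolding B (Fin.castLE hPN n))) ∧
      (∀ X : ∀ n : Fin P, Matrix (Fin (I (Fin.castLE hPN n))) (Σ r, Fin (L n r)) ℂ,
        (∀ n : Fin P, IsEigenFactor (M n) ev (L n) (X n)) →
        ∃ D : ∀ r : Fin R, CoreTensor I (fun n => L n r),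
          IsMLRankDecomposition hPN A L D X ∧
          B = ∑ r, mlTerm hPN (fun r => ev r • D r) X r ∧
          (∀ r : Fin R, mlTerm hPN (fun r => ev r • D r) X r = ev r • mlTerm hPN D X r) ∧
          (∏ r, ev r ≠ 0 →
            IsMLRankDecomposition hPN B L (fun r => ev r • D r) X) ∧
          ((∀ (n : Fin P) (r : Fin R), L n r = 1) → N ≤ P + 1 →
            ∀ r : Fin R, IsRankOneTensor (mlTerm hPN D X r)))) := by
  have hB : ∀ n, B = modeMul (Fin.castLE hPN n) (M n) A := fun n =>
    unfolding_injective (Fin.castLE hPN n) ((hM n).trans (unfolding_modeMul _ _ _).symm)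
  have hmin : ∀ n k, minpoly ℂ (M n) = minpoly ℂ (M k) := by
    intro n k
    by_cases hnk : n = k
    · subst hnk; rfl
    · exact minpoly_eq_of_modeMul_eq (fun h => hnk (Fin.castLE_injective hPN h))
        ((hB n).symm.trans (hB k)) (hA n) (hA k)
  have hdiag' : ∀ n, IsDiagonalizableMatrix (M n) := by
    obtain ⟨k, hk⟩ := hdiag
    intro n
    apply isDiagonalizableMatrix_of_minpoly_squarefree
    rw [hmin n k]
    exact minpoly_squarefree_of_isDiagonalizableMatrix hk
  refine ⟨fun n k => ?_, hdiag', fun R ev L hev hspec hmult => ⟨?_, fun n => ?_, fun X hX => ?_⟩⟩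
  · ext c
    rw [mem_spectrum_iff_isRoot_minpoly, mem_spectrum_iff_isRoot_minpoly, hmin n k]
  · choose X hX using fun n => exists_isEigenFactor (hdiag' n) hev (hspec n) (hmult n)
    exact ⟨X, hX⟩
  -- Both sides say that `M n` is invertible, that is, that zero is not an eigenvalue.
  · rw [hM n, columnSpace_mul_eq_iff (mulVec_injective_of_rank_eq (hA n)),
      ← spectrum.zero_notMem_iff ℂ, hspec n, Finset.prod_ne_zero_iff]
    simp
  · obtain ⟨D, hAD, hBD⟩ := exists_cores hP2 hPN hB hev hX
    have hrank := isMLRank_mlTerm hPN hA (fun n => (hX n).imp fun Y hY => hY.2.1)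
      (fun n => (hX n).sum_eq) hAD
    have hsmul := mlTerm_smul hPN D X ev
    refine ⟨D, ⟨hAD, hrank⟩, hBD, hsmul, fun hne => ⟨hBD, fun r n => ?_⟩, fun hL hN r => ?_⟩
    · rw [Finset.prod_ne_zero_iff] at hne
      rw [hsmul, ← hrank r n]
      exact Matrix.rank_smul_of_mem_nonZeroDivisors _
        (mem_nonZeroDivisors_of_ne_zero (hne r (Finset.mem_univ r)))
    · refine isRankOneTensor_modeProduct hP2 hPN hN (fun n => hL n r) _ _ fun h0 => ?_
      -- A zero term would have rank 0 in the first mode, where the rank is 1.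
      have h1 := hrank r ⟨0, by omega⟩
      rw [mlTerm, h0, show unfolding (0 : Tensor I) _ = 0 from rfl, Matrix.rank_zero] at h1
      exact zero_ne_one (h1.trans (hL _ r))
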